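/- Let $\Sigma=\{0,1\}$, let $\mathcal B$ be the set of all string functions $\varphi\colon\Sigma^*\to\Sigma^*$, and for $\varphi\in\mathcal B$ let $|\varphi|\colon\mathbb N\to\mathbb N$, $|\varphi|(n)=\max\{|\varphi(a)| : a\in\Sigma^*,\ |a|\le n\}$, be its size function. An oracle Turing machine $M$ with oracle $\varphi$ may, in one step, replace the content $b$ of its oracle tape by $\varphi(b)$; let $\operatorname{time}_{M^\varphi}(a)\in\mathbb N\cup\{\infty\}$ be the number of steps of its run on input $a$. For $A\subseteq\mathcal B$, $M$ computes $F\colon A\to\mathcal B$ if for all $\varphi\in A$ and $a\in\Sigma^*$ its run with oracle $\varphi$ on input $a$ halts with output $F(\varphi)(a)$. The second-order polynomials are the smallest class of functions $\mathbb N^{\mathbb N}\times\mathbb N\to\mathbb N$ that contains $(l,n)\mapsto p(n)$ for every polynomial $p$ with coefficients in $\mathbb N$ and that contains $P+Q$, $P\cdot Q$ and $(l,n)\mapsto l(P(l,n))$ whenever it contains $P$ and $Q$. For $A\subseteq\mathcal B$, let $\mathrm P(A)$ be the class of $A$-restricted polynomial-time computable functionals, i.e. of those $F\colon A\to\mathcal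 B$ that are computed by an oracle Turing machine $M$ for which there is a second-order polynomial $P$ with $\operatorname{time}_{M^\varphi}(a)\le P(|\varphi|,|a|)$ for all $\varphi\in A$ and $a\in\Sigma^*$. A total functional $G\colon\mathcal B\to\mathcal B$ is polynomial-time computable if $G\in\mathrm P(\mathcal B)$. Let $\mathrm P|_A$ be the class of all $F\colon A\to\mathcal B$ that have a polynomial-time computable extension $G\colon\mathcal B\to\mathcal B$. Theorem. $\mathrm P|_A\subseteq\mathrm P(A)$ for every $A\subseteq\mathcal B$, and in general the inclusion is strict: there are a set $A\subseteq\mathcal B$ and a functional $F\colon A\to\mathcal B$ such that $F$ is $A$-restricted polynomial-time computable but has no total polynomial-time computable extension. Namely, this holds for $$A=\{\varphi\in\mathcal B : |\varphi|(2^{2^n})\ge 2^{2^{2^n}}\text{ for all }n\in\mathbb N\},\qquad F(\varphi)(a)=0^{|\varphi|(|a|)}.$$ -/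

import Mathlib

/-- Finite binary strings; the symbol 0 is `false`, the symbol 1 is `true`. -/
abbrev Str : Type := List Bool

/-- The Baire space of string functions. -/
abbrev StrFun : Type := Str → Str

/-- The size function `|φ|(n) = max { |φ(a)| : |a| ≤ n }`. -/
noncomputable def sizeFun (φ : StrFun) (n : ℕ) : ℕ :=
  (List.finite_length_le Bool n).toFinset.sup fun a => (φ a).length

/-! ### Oracle Turing machines -/

/-- The tapes of a machine with `k` memory tapes. -/
inductive TapeId (k : ℕ) : Type
  | input
  | output
  | oracle
  | memory (i : Fin k)
  deriving DecidableEq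

/-- Head movements. -/
inductive Move : Type
  | left
  | stay
  | right

/-- The displacement of the head. -/
def Move.toInt : Move → ℤ
  | .left => -1
  | .stay => 0
  | .right => 1

/-- Tape symbols: the blank `none`, the bits, and the auxiliary symbols in `Γ`. -/
abbrev TapeSym (Γ : Type) : Type := Option (Bool ⊕ Γ)

/-- The bit written in a cell, if there is one. -/
def symBit {Γ : Type} : TapeSym Γ → Option Bool
  | some (Sum.inl b) => some b
  | _ => none

/-- The cells of a tape that carries the string `a`, starting at cell `0`, and nothing else. -/
def cellsOf {Γ : Type} (a : Str) : ℤ → TapeSym Γ :=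
  fun i => if 0 ≤ i then (a[i.toNat]?).map Sum.inl else none

open Classical in
/-- The string on a tape: the maximal block of bits that starts at cell `0`.
(The value `[]` for a tape with infinitely many consecutive bits is irrelevant, as such a tape
never occurs in a computation.) -/
noncomputable def content {Γ : Type} (c : ℤ → TapeSym Γ) : Str :=
  if h : ∃ n : ℕ, symBit (c (n : ℤ)) = none then
    (List.range (Nat.find h)).filterMap fun i : ℕ => symBit (c (i : ℤ))
  else []

/-- A deterministic multi-tape oracle Turing machine: finite sets of states and auxiliary symbols,
an input, an output and an oracle tape, `k` memory tapes, and distinguished start, halting,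
query and answer states. The transition function is ignored in the halting and query states. -/
structure OracleTM where
  State : Type
  finite_state : Finite State
  Aux : Type
  finite_aux : Finite Aux
  k : ℕ
  start : State
  halt : State
  query : State
  answer : State
  trans : State → (TapeId k → TapeSym Aux) → State × (TapeId k → TapeSym Aux × Move)

namespace OracleTM

/-- A configuration: the state, the contents of all (two-way infinite) tapes, and the positions
of all heads. -/
structure Config (M : OracleTM) where
  state : M.State
  cells : TapeId M.k → ℤ → TapeSym M.Aux
  head : TapeId M.k → ℤ

/-- The initial configuration on input `a`. -/
def init (M : OracleTM) (a : Str) : M.Config where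
  state := M.start
  cells := Function.update (fun _ _ => none) TapeId.input (cellsOf a)
  head := fun _ => 0

open Classical in
/-- One step with oracle `φ`. The halting state is final. In the query state the content `b` of
the oracle tape is replaced by `φ b`, no head moves, and the machine passes to the answer state.
In any other state the transition function is applied to the scanned symbols. -/
noncomputable def step (M : OracleTM) (φ : StrFun) (c : M.Config) : M.Config :=
  if c.state = M.halt then c
  else if c.state = M.query then
    { state := M.answer
      cells := Function.update c.cells TapeId.oracle
        (cellsOf (φ (content (c.cells TapeId.oracle))))
      head := c.head }
  else
    let r := M.trans c.state fun i => c.cells i (c.head i)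
    { state := r.1
      cells := fun i => Function.update (c.cells i) (c.head i) (r.2 i).1
      head := fun i => c.head i + (r.2 i).2.toInt }

/-- The configuration after `t` steps with oracle `φ` on input `a`. -/
noncomputable def run (M : OracleTM) (φ : StrFun) (a : Str) (t : ℕ) : M.Config :=
  (M.step φ)^[t] (M.init a)

/-- The number of steps until the machine halts with oracle `φ` on input `a`; it is `⊤` if the
computation diverges. -/
noncomputable def time (M : OracleTM) (φ : StrFun) (a : Str) : ℕ∞ :=
  sInf {T : ℕ∞ | ∃ t : ℕ, T = t ∧ (M.run φ a t).state = M.halt}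

/-- With oracle `φ` and on input `a`, the machine halts with the string `b` on the output tape. -/
def Returns (M : OracleTM) (φ : StrFun) (a b : Str) : Prop :=
  ∃ t : ℕ, (M.run φ a t).state = M.halt ∧ content ((M.run φ a t).cells TapeId.output) = b

/-- The machine computes the functional `F` with domain `A`. -/
def Computes (M : OracleTM) {A : Set StrFun} (F : A → StrFun) : Prop :=
  ∀ (φ : A) (a : Str), M.Returns φ a (F φ a)

end OracleTM

/-! ### Second-order polynomials and polynomial time -/

/-- The class of second-order polynomials. -/
inductive IsSecondOrderPoly : ((ℕ → ℕ) → ℕ → ℕ) → Prop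
  | poly (p : Polynomial ℕ) : IsSecondOrderPoly fun _ n => p.eval n
  | add {P Q : (ℕ → ℕ) → ℕ → ℕ} (hP : IsSecondOrderPoly P) (hQ : IsSecondOrderPoly Q) :
      IsSecondOrderPoly fun l n => P l n + Q l n
  | mul {P Q : (ℕ → ℕ) → ℕ → ℕ} (hP : IsSecondOrderPoly P) (hQ : IsSecondOrderPoly Q) :
      IsSecondOrderPoly fun l n => P l n * Q l n
  | app {P : (ℕ → ℕ) → ℕ → ℕ} (hP : IsSecondOrderPoly P) :
      IsSecondOrderPoly fun l n => l (P l n)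

/-- `P(A)`: the functionals `F : A → (Str → Str)` that are `A`-restricted polynomial-time
computable, i.e. computed by a machine whose running time is bounded by a second-order polynomial
on all oracles from `A`. -/
def PolyTimeOn (A : Set StrFun) : Set (A → StrFun) :=
  {F | ∃ (M : OracleTM) (P : (ℕ → ℕ) → ℕ → ℕ), IsSecondOrderPoly P ∧ M.Computes F ∧
    ∀ φ ∈ A, ∀ a : Str, M.time φ a ≤ (P (sizeFun φ) a.length : ℕ∞)}

/-- A total functional is polynomial-time computable if it is computed by a machine whose running
time is bounded by a second-order polynomial on all oracles. -/
def PolyTimeComputable (G : StrFun → StrFun) : Prop :=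
  ∃ (M : OracleTM) (P : (ℕ → ℕ) → ℕ → ℕ), IsSecondOrderPoly P ∧
    (∀ (φ : StrFun) (a : Str), M.Returns φ a (G φ a)) ∧
    ∀ (φ : StrFun) (a : Str), M.time φ a ≤ (P (sizeFun φ) a.length : ℕ∞)

/-- `P|_A`: the functionals on `A` that have a total polynomial-time computable extension. -/
def PolyTimeExtendable (A : Set StrFun) : Set (A → StrFun) :=
  {F | ∃ G : StrFun → StrFun, PolyTimeComputable G ∧ ∀ φ : A, G φ = F φ}

/-! ### Runs of oracle machines -/

/-! The inclusion is immediate: a machine for the extension also serves on `A`.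

No total extension: a machine that is polynomial on all oracles must be so on oracles outside `A`.
Put `N = 2 ^ 2 ^ n` and let every answer be one fixed string of length `2 ^ N`. On a constant size
function a second-order polynomial is an ordinary one (`IsSecondOrderPoly.const_le`), so on inputs
of length `N ^ 2` the run takes fewer than `2 ^ N ^ 2` steps and misses some string of that length.
Lengthening all answers off the oracle contents of the run gives an oracle in `A` with the same run
(`run_congr`), but a value longer than the output.

Restricted computability: on `A`, `|φ|(m ^ 2 + 2) ≥ 2 ^ m` (`two_pow_le_sizeFun`), so exhaustive
search over exponentially many strings is within a second-order polynomial. The search counts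
through the ternary words of length `m`, whose maximal bit prefixes are exactly the strings of
length at most `m`; the output tape accumulates the maximum answer length in unary
(`searchTM.run_halts`). -/

theorem length_le_sizeFun (φ : StrFun) {a : Str} {n : ℕ} (h : a.length ≤ n) :
    (φ a).length ≤ sizeFun φ n :=
  Finset.le_sup (f := fun a => (φ a).length) ((List.finite_length_le Bool n).mem_toFinset.2 h)

theorem sizeFun_le {φ : StrFun} {n B : ℕ} (h : ∀ a : Str, a.length ≤ n → (φ a).length ≤ B) :
    sizeFun φ n ≤ B :=
  Finset.sup_le fun a ha => h a ((List.finite_length_le Bool n).mem_toFinset.1 ha)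

theorem sizeFun_mono (φ : StrFun) : Monotone (sizeFun φ) := fun _ _ h =>
  sizeFun_le fun _ ha => length_le_sizeFun φ (ha.trans h)

theorem sizeFun_const (b : Str) : sizeFun (fun _ => b) = fun _ => b.length := by
  funext n
  exact le_antisymm (sizeFun_le fun _ _ => le_rfl)
    (length_le_sizeFun (fun _ => b) (a := []) (Nat.zero_le n))

namespace OracleTM

variable {M : OracleTM} {φ ψ : StrFun} {a b b' : Str}

theorem step_of_halt {c : M.Config} (h : c.state = M.halt) : M.step φ c = c := by
  simp [step, h]

theorem run_succ (t : ℕ) : M.run φ a (t + 1) = M.step φ (M.run φ a t) :=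
  Function.iterate_succ_apply' _ _ _

theorem run_eq_of_halt {s t : ℕ} (h : (M.run φ a s).state = M.halt) (hst : s ≤ t) :
    M.run φ a t = M.run φ a s := by
  induction t, hst using Nat.le_induction with
  | base => rfl
  | succ t _ ih => rw [run_succ, ih, step_of_halt h]

theorem Returns.unique (h : M.Returns φ a b) (h' : M.Returns φ a b') : b = b' := by
  obtain ⟨s, hs, rfl⟩ := h
  obtain ⟨t, ht, rfl⟩ := h'
  rcases le_total s t with hst | hst
  · rw [run_eq_of_halt hs hst]
  · rw [run_eq_of_halt ht hst]

theorem time_le_iff {T : ℕ} :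
    M.time φ a ≤ T ↔ ∃ t ≤ T, (M.run φ a t).state = M.halt := by
  constructor
  · intro h
    have hne : {T : ℕ∞ | ∃ t : ℕ, T = t ∧ (M.run φ a t).state = M.halt}.Nonempty := by
      by_contra hne
      rw [Set.not_nonempty_iff_eq_empty] at hne
      simp [time, hne] at h
    obtain ⟨t, ht, hh⟩ := csInf_mem hne
    refine ⟨t, ?_, hh⟩
    rw [time, ht] at h
    exact_mod_cast h
  · rintro ⟨t, ht, hh⟩
    exact (sInf_le (show (t : ℕ∞) ∈ {T : ℕ∞ | ∃ t : ℕ, T = t ∧ (M.run φ a t).state = M.halt} from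
      ⟨t, rfl, hh⟩)).trans (by exact_mod_cast ht)

open Classical in
/-- The strings on the oracle tape during the first `t` steps; they include all queries. -/
noncomputable def oracleContents (M : OracleTM) (φ : StrFun) (a : Str) (t : ℕ) : Finset Str :=
  (Finset.range t).image fun i => content ((M.run φ a i).cells TapeId.oracle)

theorem card_oracleContents_le (t : ℕ) : (M.oracleContents φ a t).card ≤ t := by
  classical exact Finset.card_image_le.trans (Finset.card_range t).le

/-- A step consults the oracle only at the current content of the oracle tape. -/
theorem run_congr {t : ℕ} (h : ∀ b ∈ M.oracleContents φ a t, ψ b = φ b) :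
    M.run ψ a t = M.run φ a t := by
  suffices ∀ s ≤ t, M.run ψ a s = M.run φ a s from this t le_rfl
  intro s
  induction s with
  | zero => intro _; rfl
  | succ s ih =>
    intro hs
    rw [run_succ, run_succ, ih (by omega)]
    have := h (content ((M.run φ a s).cells TapeId.oracle)) (by
      classical exact Finset.mem_image.2 ⟨s, Finset.mem_range.2 (by omega), rfl⟩)
    simp only [step, this]

end OracleTM

theorem PolyTimeExtendable_subset (A : Set StrFun) : PolyTimeExtendable A ⊆ PolyTimeOn A := by
  rintro F ⟨G, ⟨M, P, hP, hG, hT⟩, hF⟩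
  exact ⟨M, P, hP, fun φ a => hF φ ▸ hG φ a, fun φ _ a => hT φ a⟩

/-! ### The functional has no total polynomial-time extension -/

/-- For constant `l`, each application `l (P l n)` collapses to `L`, so nesting causes no growth. -/
theorem IsSecondOrderPoly.const_le {P : (ℕ → ℕ) → ℕ → ℕ} (hP : IsSecondOrderPoly P) :
    ∃ C k : ℕ, ∀ L n : ℕ, P (fun _ => L) n ≤ C * (L + n + 1) ^ k := by
  induction hP with
  | poly p =>
    induction p using Polynomial.induction_on' with
    | add p q hp hq =>
      obtain ⟨C, k, h⟩ := hp
      obtain ⟨C', k', h'⟩ := hq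
      refine ⟨C + C', k + k', fun L n => ?_⟩
      simp only [Polynomial.eval_add, add_mul]
      refine add_le_add ((h L n).trans ?_) ((h' L n).trans ?_) <;> gcongr <;> omega
    | monomial i c =>
      refine ⟨c, i, fun L n => ?_⟩
      simp only [Polynomial.eval_monomial]
      gcongr
      omega
  | add _ _ ihP ihQ =>
    obtain ⟨C, k, h⟩ := ihP
    obtain ⟨C', k', h'⟩ := ihQ
    refine ⟨C + C', k + k', fun L n => ?_⟩
    rw [add_mul]
    refine add_le_add ((h L n).trans ?_) ((h' L n).trans ?_) <;> gcongr <;> omega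
  | mul _ _ ihP ihQ =>
    obtain ⟨C, k, h⟩ := ihP
    obtain ⟨C', k', h'⟩ := ihQ
    refine ⟨C * C', k + k', fun L n => (Nat.mul_le_mul (h L n) (h' L n)).trans_eq ?_⟩
    ring
  | app _ _ => exact ⟨1, 1, fun L n => by simp; omega⟩

theorem exists_poly_lt_two_pow (C k : ℕ) :
    ∃ n : ℕ, C * (2 ^ 2 ^ 2 ^ n + 2 ^ 2 ^ (n + 1) + 1) ^ k < 2 ^ 2 ^ 2 ^ (n + 1) := by
  -- With `N = 2 ^ 2 ^ n ≥ n`, this choice gives both `N ≥ 4`, for `N ^ 2 ≤ 2 ^ N`, and `C + (N + 2)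
  -- * k < N ^ 2` for the final exponents.
  refine ⟨C + 2 * k + 4, ?_⟩
  generalize hn : C + 2 * k + 4 = n
  have hsq : 2 ^ 2 ^ (n + 1) = (2 ^ 2 ^ n) ^ 2 := by rw [← pow_mul, pow_succ]
  have hN : n ≤ 2 ^ 2 ^ n :=
    Nat.lt_two_pow_self.le.trans Nat.lt_two_pow_self.le
  rw [hsq]
  generalize 2 ^ 2 ^ n = N at hN
  have hN2 : N ^ 2 ≤ 2 ^ N := by
    have : 4 ≤ N := by omega
    clear hN hsq
    induction N, this using Nat.le_induction with
    | base => norm_num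
    | succ N h ih => rw [pow_succ 2]; nlinarith
  have h1 : 2 ^ N + N ^ 2 + 1 ≤ 2 ^ (N + 2) := by
    have := Nat.one_le_two_pow (n := N)
    rw [pow_add]; omega
  calc C * (2 ^ N + N ^ 2 + 1) ^ k ≤ 2 ^ C * (2 ^ (N + 2)) ^ k := by
        gcongr
        exact Nat.lt_two_pow_self.le
    _ = 2 ^ (C + (N + 2) * k) := by rw [pow_add 2 C, pow_mul]
    _ < 2 ^ N ^ 2 := by
        refine Nat.pow_lt_pow_right (by norm_num) ?_
        nlinarith

theorem exists_length_eq_notMem (S : Finset Str) {m : ℕ} (h : S.card < 2 ^ m) :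
    ∃ b : Str, b.length = m ∧ b ∉ S := by
  classical
  by_contra! hc
  have : (Finset.univ : Finset (List.Vector Bool m)).image Subtype.val ⊆ S := by
    intro b hb
    obtain ⟨v, -, rfl⟩ := Finset.mem_image.1 hb
    exact hc _ v.2
  have hcard := Finset.card_le_card this
  have himage := Finset.card_image_of_injective (Finset.univ : Finset (List.Vector Bool m))
    Subtype.val_injective
  rw [Finset.card_univ, card_vector, Fintype.card_bool] at himage
  exact (himage.symm.trans_le hcard).not_gt h

theorem not_polyTimeExtendable {A : Set StrFun}
    (hA : A = {φ : StrFun | ∀ n : ℕ, 2 ^ 2 ^ 2 ^ n ≤ sizeFun φ (2 ^ 2 ^ n)}) {F : A → StrFun}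
    (hF : ∀ (φ : A) (a : Str), F φ a = List.replicate (sizeFun φ a.length) false) :
    F ∉ PolyTimeExtendable A := by
  classical
  rintro ⟨G, ⟨M, P, hP, hG, hT⟩, hGF⟩
  obtain ⟨C, k, hCk⟩ := hP.const_le
  obtain ⟨n, hn⟩ := exists_poly_lt_two_pow C k
  set a : Str := List.replicate (2 ^ 2 ^ (n + 1)) false with ha
  have hal : a.length = 2 ^ 2 ^ (n + 1) := List.length_replicate
  -- This oracle violates the growth condition at `n + 1`; the time bound applies because it is
  -- total.
  set ψ : StrFun := fun _ => List.replicate (2 ^ 2 ^ 2 ^ n) false with hψ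
  obtain ⟨t, ht, hhalt⟩ := OracleTM.time_le_iff.1 (hT ψ a)
  have htlt : t < 2 ^ 2 ^ 2 ^ (n + 1) := by
    rw [hψ, sizeFun_const, List.length_replicate, hal] at ht
    exact (ht.trans (hCk _ _)).trans_lt hn
  set S := M.oracleContents ψ a t with hS
  have hfresh (j : ℕ) (hj : n + 1 ≤ j) : ∃ b : Str, b.length = 2 ^ 2 ^ j ∧ b ∉ S := by
    refine exists_length_eq_notMem S ((M.card_oracleContents_le t).trans_lt (htlt.trans_le ?_))
    gcongr <;> norm_num
  set r := content ((M.run ψ a t).cells TapeId.output) with hr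
  -- Of the three summands, the first keeps the condition at levels up to `n`, the second yields it
  -- at higher levels through fresh strings, and the third exceeds the output `r`.
  let φ : StrFun := fun b =>
    if b ∈ S then ψ b else List.replicate (2 ^ 2 ^ 2 ^ n + 2 ^ b.length + (r.length + 1)) false
  have hφ {b : Str} (hb : b ∉ S) :
      (φ b).length = 2 ^ 2 ^ 2 ^ n + 2 ^ b.length + (r.length + 1) := by
    simp [φ, hb]
  have hle (b : Str) : 2 ^ 2 ^ 2 ^ n ≤ (φ b).length := by
    by_cases hb : b ∈ S
    · simp [φ, hb, hψ]
    · rw [hφ hb, add_assoc]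
      exact Nat.le_add_right _ _
  have hmem : φ ∈ A := by
    rw [hA]
    intro j
    rcases Nat.lt_or_ge n j with hj | hj
    · obtain ⟨b, hbl, hb⟩ := hfresh j hj
      have h1 := length_le_sizeFun φ hbl.le
      rw [hφ hb, hbl, add_assoc] at h1
      exact ((Nat.le_add_right _ _).trans (Nat.le_add_left _ _)).trans h1
    · calc 2 ^ 2 ^ 2 ^ j ≤ 2 ^ 2 ^ 2 ^ n := by gcongr <;> norm_num
        _ ≤ (φ []).length := hle []
        _ ≤ _ := length_le_sizeFun φ (Nat.zero_le _)
  have hrun : M.run φ a t = M.run ψ a t := OracleTM.run_congr fun b hb => if_pos hb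
  have hret : M.Returns φ a r := ⟨t, by rw [hrun, hhalt], by rw [hrun]⟩
  have heq : r = List.replicate (sizeFun φ a.length) false := by
    rw [← hF ⟨φ, hmem⟩ a, ← hGF ⟨φ, hmem⟩]
    exact hret.unique (hG φ a)
  obtain ⟨b, hbl, hb⟩ := hfresh (n + 1) le_rfl
  have h1 := length_le_sizeFun φ (hbl.trans hal.symm).le
  have h2 := congrArg List.length heq
  rw [hφ hb] at h1
  rw [List.length_replicate] at h2
  exact absurd (((Nat.le_add_left _ _).trans h1).trans h2.ge) (Nat.not_succ_le_self r.length)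

/-! ### Tapes -/

/-- The tape that carries the word `w` from cell `0` on, and nothing else. -/
def tapeOf {Γ : Type} (w : List (Bool ⊕ Γ)) : ℤ → TapeSym Γ :=
  fun i => if 0 ≤ i then w[i.toNat]? else none

section Tapes

variable {Γ : Type}

@[simp] theorem tapeOf_natCast (w : List (Bool ⊕ Γ)) (i : ℕ) : tapeOf w i = w[i]? := by
  simp [tapeOf]

theorem tapeOf_of_neg (w : List (Bool ⊕ Γ)) {i : ℤ} (h : i < 0) : tapeOf w i = none :=
  if_neg h.not_ge

theorem cellsOf_eq_tapeOf (a : Str) : (cellsOf a : ℤ → TapeSym Γ) = tapeOf (a.map Sum.inl) := by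
  funext i
  simp [cellsOf, tapeOf]

theorem update_tapeOf (w : List (Bool ⊕ Γ)) {i : ℕ} (h : i < w.length) (d : Bool ⊕ Γ) :
    Function.update (tapeOf w) (i : ℤ) (some d) = tapeOf (w.set i d) := by
  funext j
  rcases lt_or_ge j 0 with hj | hj
  · rw [Function.update_of_ne (by omega), tapeOf_of_neg _ hj, tapeOf_of_neg _ hj]
  · lift j to ℕ using hj
    rw [tapeOf_natCast, List.getElem?_set]
    by_cases hij : i = j
    · subst hij
      simp [h]
    · rw [Function.update_of_ne (by omega), tapeOf_natCast, if_neg hij]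

/-- Covers overwriting inside the block and extending it by one cell; this is how the output tape
records a maximum. -/
theorem update_tapeOf_replicate (d : Bool ⊕ Γ) {r i : ℕ} (h : i ≤ r) :
    Function.update (tapeOf (List.replicate r d)) (i : ℤ) (some d) =
      tapeOf (List.replicate (max r (i + 1)) d) := by
  funext j
  rcases lt_or_ge j 0 with hj | hj
  · rw [Function.update_of_ne (by omega), tapeOf_of_neg _ hj, tapeOf_of_neg _ hj]
  · lift j to ℕ using hj
    rw [tapeOf_natCast, List.getElem?_replicate]
    by_cases hij : i = j
    · subst hij
      simp
    · rw [Function.update_of_ne (by omega), tapeOf_natCast, List.getElem?_replicate]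
      congr 1
      simp only [eq_iff_iff]
      omega

theorem filterMap_range_getElem? {α : Type*} (l : List α) :
    (List.range l.length).filterMap (fun i => l[i]?) = l := by
  induction l with
  | nil => rfl
  | cons x l ih =>
    rw [List.length_cons, List.range_succ_eq_map, List.filterMap_cons]
    simpa [List.filterMap_map, Function.comp_def] using ih

theorem content_eq {c : ℤ → TapeSym Γ} {b : Str}
    (h : ∀ i : ℕ, i ≤ b.length → symBit (c i) = b[i]?) : content c = b := by
  have hex : ∃ n : ℕ, symBit (c (n : ℤ)) = none := ⟨b.length, by rw [h _ le_rfl]; simp⟩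
  have hfind : Nat.find hex = b.length := by
    rw [Nat.find_eq_iff]
    refine ⟨by rw [h _ le_rfl]; simp, fun i hi => ?_⟩
    rw [h _ hi.le]
    simp [hi]
  rw [content, dif_pos hex, hfind]
  conv_rhs => rw [← filterMap_range_getElem? b]
  refine List.filterMap_congr fun i hi => ?_
  rw [List.mem_range] at hi
  exact h i hi.le

/-- The maximal prefix of bits. -/
def bitPrefix : List (Bool ⊕ Γ) → Str
  | Sum.inl b :: w => b :: bitPrefix w
  | _ => []

theorem length_bitPrefix_le (w : List (Bool ⊕ Γ)) : (bitPrefix w).length ≤ w.length := by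
  induction w with
  | nil => simp [bitPrefix]
  | cons d w ih => cases d <;> simp [bitPrefix, ih]

theorem symBit_getElem? (w : List (Bool ⊕ Γ)) {i : ℕ} (h : i ≤ (bitPrefix w).length) :
    symBit w[i]? = (bitPrefix w)[i]? := by
  induction w generalizing i with
  | nil => simp [bitPrefix, symBit]
  | cons d w ih =>
    rcases d with b | d
    · cases i with
      | zero => simp [bitPrefix, symBit]
      | succ i => simpa [bitPrefix] using ih (by simpa [bitPrefix] using h)
    · obtain rfl : i = 0 := by simpa [bitPrefix] using h
      simp [bitPrefix, symBit]

/-- Cells beyond the one just after `w` are unconstrained, so remnants of an old answer on the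
oracle tape are harmless. -/
theorem content_eq_bitPrefix {c : ℤ → TapeSym Γ} (w : List (Bool ⊕ Γ))
    (h : ∀ i : ℕ, i ≤ w.length → c i = w[i]?) : content c = bitPrefix w :=
  content_eq fun i hi => by
    rw [h i (hi.trans (length_bitPrefix_le w)), symBit_getElem? w hi]

/-- Padding with end markers: words of one fixed length encode all shorter strings too. -/
theorem bitPrefix_map_append (a : Str) (n : ℕ) (d : Γ) :
    bitPrefix (a.map Sum.inl ++ List.replicate n (Sum.inr d)) = a := by
  induction a with
  | nil => cases n <;> simp [bitPrefix, List.replicate_succ]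
  | cons b a ih => simpa [bitPrefix] using ih

end Tapes

/-! ### A ternary odometer -/

/-- Digits of the odometer: the bits `0` and `1`, and an end marker. -/
abbrev Digit : Type := Bool ⊕ Unit

/-- What a pass over a word does: set all digits to `0`, add one, or change nothing. -/
inductive PassMode : Type
  | reset
  | carry
  | copy

instance : Finite PassMode :=
  Finite.of_surjective ![PassMode.reset, PassMode.carry, PassMode.copy]
    (by rintro ⟨⟩; exacts [⟨0, rfl⟩, ⟨1, rfl⟩, ⟨2, rfl⟩])

/-- The new digit and the mode in which the pass goes on. -/
def PassMode.next : PassMode → Digit → Digit × PassMode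
  | reset, _ => (Sum.inl false, reset)
  | copy, d => (d, copy)
  | carry, Sum.inl false => (Sum.inl true, copy)
  | carry, Sum.inl true => (Sum.inr (), copy)
  | carry, Sum.inr _ => (Sum.inl false, carry)

/-- The word after a pass, and the mode at its end. -/
def PassMode.pass : PassMode → List Digit → List Digit × PassMode
  | c, [] => ([], c)
  | c, d :: w => ((c.next d).1 :: ((c.next d).2.pass w).1, ((c.next d).2.pass w).2)

/-- The value of a digit. -/
def digitVal : Digit → ℕ
  | Sum.inl false => 0
  | Sum.inl true => 1
  | Sum.inr _ => 2

/-- The number with a given ternary expansion, least significant digit first. -/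
def wordVal : List Digit → ℕ
  | [] => 0
  | d :: w => digitVal d + 3 * wordVal w

theorem digitVal_lt (d : Digit) : digitVal d < 3 := by
  rcases d with (_ | _) | _ <;> simp [digitVal]

theorem digitVal_injective : Function.Injective digitVal := by
  rintro ((_ | _) | _) ((_ | _) | _) h <;> simp_all [digitVal]

theorem wordVal_lt (w : List Digit) : wordVal w < 3 ^ w.length := by
  induction w with
  | nil => simp [wordVal]
  | cons d w ih =>
    have := digitVal_lt d
    simp only [wordVal, List.length_cons, pow_succ]
    omega

theorem eq_of_wordVal_eq {v w : List Digit} (hl : v.length = w.length)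
    (h : wordVal v = wordVal w) : v = w := by
  induction v generalizing w with
  | nil => exact (List.length_eq_zero_iff.1 hl.symm).symm
  | cons d v ih =>
    cases w with
    | nil => simp at hl
    | cons e w =>
      have hd := digitVal_lt d
      have he := digitVal_lt e
      simp only [wordVal] at h
      rw [digitVal_injective (show digitVal d = digitVal e by omega),
        ih (by simpa using hl) (by omega)]

theorem wordVal_replicate (n : ℕ) : wordVal (List.replicate n (Sum.inl false)) = 0 := by
  induction n with
  | zero => rfl
  | succ n ih => simp [List.replicate_succ, wordVal, digitVal, ih]

namespace PassMode

theorem length_pass (c : PassMode) (w : List Digit) : (c.pass w).1.length = w.length := by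
  induction w generalizing c with
  | nil => rfl
  | cons d w ih => simp [pass, ih]

theorem reset_pass (w : List Digit) :
    reset.pass w = (List.replicate w.length (Sum.inl false), reset) := by
  induction w with
  | nil => rfl
  | cons d w ih => simp [pass, next, ih, List.replicate_succ]

theorem copy_pass (w : List Digit) : copy.pass w = (w, copy) := by
  induction w with
  | nil => rfl
  | cons d w ih => simp [pass, next, ih]

/-- The carry survives the pass exactly when all digits are `2`, i.e. at the last word; the machine
takes this as the signal to halt. -/
theorem carry_pass (w : List Digit) :
    (carry.pass w).2 = carry ∧ wordVal w + 1 = 3 ^ w.length ∨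
      (carry.pass w).2 = copy ∧ wordVal (carry.pass w).1 = wordVal w + 1 := by
  induction w with
  | nil => left; simp [pass, wordVal]
  | cons d w ih =>
    rcases d with (_ | _) | _
    · right; simp [pass, next, copy_pass, wordVal, digitVal]; omega
    · right; simp [pass, next, copy_pass, wordVal, digitVal]; omega
    · simp only [pass, next, wordVal, digitVal, List.length_cons, pow_succ]
      rcases ih with ⟨h1, h2⟩ | ⟨h1, h2⟩
      · left; exact ⟨h1, by omega⟩
      · right; exact ⟨h1, by omega⟩

end PassMode

/-! ### The exhaustive search machine -/

/-- States of the exhaustive search machine. -/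
inductive SearchState : Type
  | scan (c : PassMode)
  | rewind
  | query
  | answer
  | back
  | halt

instance : Finite SearchState :=
  Finite.of_surjective
    (Sum.elim SearchState.scan ![SearchState.rewind, SearchState.query, SearchState.answer,
      SearchState.back, SearchState.halt])
    (by
      rintro (c | _ | _ | _ | _ | _)
      exacts [⟨Sum.inl c, rfl⟩, ⟨Sum.inr 0, rfl⟩, ⟨Sum.inr 1, rfl⟩, ⟨Sum.inr 2, rfl⟩,
        ⟨Sum.inr 3, rfl⟩, ⟨Sum.inr 4, rfl⟩])

/-- The action of a machine without memory tapes that writes and moves as given on the input, the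
output and the oracle tape. -/
def action {Γ : Type} (i o q : TapeSym Γ × Move) : TapeId 0 → TapeSym Γ × Move
  | .input => i
  | .output => o
  | .oracle => q
  | .memory j => j.elim0

/-- The transitions of the exhaustive search machine, depending on the scanned symbols on the
input, the output and the oracle tape. -/
def searchTrans (s : SearchState) (i o q : TapeSym Unit) :
    SearchState × (TapeId 0 → TapeSym Unit × Move) :=
  match s with
  | .scan c =>
    match i with
    | some d =>
      (.scan (c.next d).2,
        action (some (c.next d).1, .right) (o, .stay) (some (c.next d).1, .right))
    | none =>
      match c with
      | .carry => (.halt, action (none, .stay) (o, .stay) (q, .stay))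
      | _ => (.rewind, action (none, .left) (o, .stay) (none, .left))
  | .rewind =>
    match i with
    | some d => (.rewind, action (some d, .left) (o, .stay) (q, .left))
    | none => (.query, action (none, .right) (o, .stay) (q, .right))
  | .answer =>
    match q with
    | some d => (.answer, action (i, .stay) (some (Sum.inl false), .right) (some d, .right))
    | none => (.back, action (i, .stay) (o, .left) (none, .left))
  | .back =>
    match q with
    | some d => (.back, action (i, .stay) (o, .left) (some d, .left))
    | none => (.scan .carry, action (i, .stay) (o, .right) (none, .right))
  | s => (s, action (i, .stay) (o, .stay) (q, .stay))

/-- The machine that asks the oracle for its values on all strings that are at most as long as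
the input, and overwrites the output tape with zeros along each of the answers. The words of the
odometer are kept on the input tape. -/
@[reducible] def searchTM : OracleTM where
  State := SearchState
  finite_state := inferInstance
  Aux := Unit
  finite_aux := inferInstance
  k := 0
  start := .scan .reset
  halt := .halt
  query := .query
  answer := .answer
  trans s f := searchTrans s (f .input) (f .output) (f .oracle)

namespace searchTM

/-- Configurations of the search machine: the state, and the cells and heads of the input, the
output and the oracle tape. -/
def cfg (s : SearchState) (I O Q : ℤ → TapeSym Unit) (i o q : ℤ) : searchTM.Config where
  state := s
  cells
    | .input => I
    | .output => O
    | .oracle => Q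
    | .memory j => j.elim0
  head
    | .input => i
    | .output => o
    | .oracle => q
    | .memory j => j.elim0

theorem init_eq (a : Str) :
    searchTM.init a = cfg (.scan .reset) (tapeOf (a.map Sum.inl)) (fun _ => none)
      (fun _ => none) 0 0 0 := by
  simp only [OracleTM.init, cfg, OracleTM.Config.mk.injEq, true_and]
  constructor
  · funext t
    rcases t with _ | _ | _ | j
    · simp [cellsOf_eq_tapeOf]
    · simp
    · simp
    · exact j.elim0
  · funext t
    rcases t with _ | _ | _ | j
    · rfl
    · rfl
    · rfl
    · exact j.elim0

variable {φ : StrFun} {I O Q : ℤ → TapeSym Unit} {i o q : ℤ}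

/-! ### Single steps of the search machine -/

theorem step_cfg {s s' : SearchState} {x y z : TapeSym Unit × Move}
    (hh : s ≠ .halt) (hq : s ≠ .query)
    (h : searchTrans s (I i) (O o) (Q q) = (s', action x y z)) :
    searchTM.step φ (cfg s I O Q i o q) =
      cfg s' (Function.update I i x.1) (Function.update O o y.1) (Function.update Q q z.1)
        (i + x.2.toInt) (o + y.2.toInt) (q + z.2.toInt) := by
  have h' : searchTM.trans (cfg s I O Q i o q).state
      (fun t => (cfg s I O Q i o q).cells t ((cfg s I O Q i o q).head t)) =
        (s', action x y z) := h
  have hh' : (cfg s I O Q i o q).state ≠ searchTM.halt := hh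
  have hq' : (cfg s I O Q i o q).state ≠ searchTM.query := hq
  rw [OracleTM.step, if_neg hh', if_neg hq', h']
  simp only [cfg, OracleTM.Config.mk.injEq, true_and]
  constructor
  · funext t
    rcases t with _ | _ | _ | j
    · rfl
    · rfl
    · rfl
    · exact j.elim0
  · funext t
    rcases t with _ | _ | _ | j
    · rfl
    · rfl
    · rfl
    · exact j.elim0

theorem step_query :
    searchTM.step φ (cfg .query I O Q i o q) =
      cfg .answer I O (tapeOf ((φ (content Q)).map Sum.inl)) i o q := by
  have hq : (cfg .query I O Q i o q).state = searchTM.query := rfl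
  rw [OracleTM.step, if_neg (by simp [cfg]), if_pos hq]
  simp only [cfg, OracleTM.Config.mk.injEq, true_and, and_true]
  funext t
  rcases t with _ | _ | _ | j
  · simp
  · simp
  · simp [cellsOf_eq_tapeOf]
  · exact j.elim0

theorem step_scan {d : Digit} {c : PassMode} (h : I i = some d) :
    searchTM.step φ (cfg (.scan c) I O Q i o q) =
      cfg (.scan (c.next d).2) (Function.update I i (some (c.next d).1)) O
        (Function.update Q q (some (c.next d).1)) (i + 1) o (q + 1) := by
  refine (step_cfg (by simp) (by simp) (by rw [h]; rfl)).trans ?_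
  simp [Move.toInt]

theorem step_scan_carry_none (h : I i = none) :
    searchTM.step φ (cfg (.scan .carry) I O Q i o q) = cfg .halt I O Q i o q := by
  refine (step_cfg (by simp) (by simp) (by rw [h]; rfl)).trans ?_
  simp [Move.toInt, ← h]

theorem step_scan_none {c : PassMode} (hc : c ≠ .carry) (h : I i = none) :
    searchTM.step φ (cfg (.scan c) I O Q i o q) =
      cfg .rewind I O (Function.update Q q none) (i - 1) o (q - 1) := by
  rw [step_cfg (s' := .rewind) (x := (none, .left)) (y := (O o, .stay)) (z := (none, .left))
    (by simp) (by simp) (by cases c <;> simp_all [searchTrans])]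
  simp [Move.toInt, ← h, sub_eq_add_neg]

theorem step_rewind {d : Digit} (h : I i = some d) :
    searchTM.step φ (cfg .rewind I O Q i o q) = cfg .rewind I O Q (i - 1) o (q - 1) := by
  refine (step_cfg (by simp) (by simp) (by rw [h]; rfl)).trans ?_
  simp [Move.toInt, ← h, sub_eq_add_neg]

theorem step_rewind_none (h : I i = none) :
    searchTM.step φ (cfg .rewind I O Q i o q) = cfg .query I O Q (i + 1) o (q + 1) := by
  refine (step_cfg (by simp) (by simp) (by rw [h]; rfl)).trans ?_
  simp [Move.toInt, ← h]

theorem step_answer {d : Digit} (h : Q q = some d) :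
    searchTM.step φ (cfg .answer I O Q i o q) =
      cfg .answer I (Function.update O o (some (Sum.inl false))) Q i (o + 1) (q + 1) := by
  refine (step_cfg (by simp) (by simp) (by rw [h]; rfl)).trans ?_
  simp [Move.toInt, ← h]

theorem step_answer_none (h : Q q = none) :
    searchTM.step φ (cfg .answer I O Q i o q) = cfg .back I O Q i (o - 1) (q - 1) := by
  refine (step_cfg (by simp) (by simp) (by rw [h]; rfl)).trans ?_
  simp [Move.toInt, ← h, sub_eq_add_neg]

theorem step_back {d : Digit} (h : Q q = some d) :
    searchTM.step φ (cfg .back I O Q i o q) = cfg .back I O Q i (o - 1) (q - 1) := by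
  refine (step_cfg (by simp) (by simp) (by rw [h]; rfl)).trans ?_
  simp [Move.toInt, ← h, sub_eq_add_neg]

theorem step_back_none (h : Q q = none) :
    searchTM.step φ (cfg .back I O Q i o q) = cfg (.scan .carry) I O Q i (o + 1) (q + 1) := by
  refine (step_cfg (by simp) (by simp) (by rw [h]; rfl)).trans ?_
  simp [Move.toInt, ← h]

/-! ### Phases of a round and the main loop -/

theorem scan (v : List Digit) (u : List Digit) (c : PassMode) (Q : ℤ → TapeSym Unit)
    (hQ : ∀ i : ℕ, i < u.length → Q i = u[i]?) :
    ∃ Q' : ℤ → TapeSym Unit,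
      (searchTM.step φ)^[v.length]
          (cfg (.scan c) (tapeOf (u ++ v)) O Q (u.length : ℕ) o (u.length : ℕ)) =
        cfg (.scan (c.pass v).2) (tapeOf (u ++ (c.pass v).1)) O Q' (u.length + v.length : ℕ) o
          (u.length + v.length : ℕ) ∧
      ∀ i : ℕ, i < u.length + v.length → Q' i = (u ++ (c.pass v).1)[i]? := by
  induction v generalizing u c Q with
  | nil => exact ⟨Q, by simp [PassMode.pass], by simpa [PassMode.pass] using hQ⟩
  | cons d v ih =>
    obtain ⟨Q', h1, h2⟩ := ih (u ++ [(c.next d).1]) (c.next d).2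
      (Function.update Q (u.length : ℕ) (some (c.next d).1)) (by
        intro i hi
        rw [List.length_append, List.length_singleton] at hi
        rcases Nat.lt_succ_iff_lt_or_eq.1 hi with hi | rfl
        · rw [Function.update_of_ne (by omega), hQ i hi, List.getElem?_append_left hi]
        · simp)
    have hl : (u ++ [(c.next d).1]).length + v.length = u.length + (d :: v).length := by
      simp; omega
    refine ⟨Q', ?_, ?_⟩
    · rw [List.length_cons, Function.iterate_succ_apply, step_scan (d := d) (by simp),
        update_tapeOf _ (by simp)]
      rw [hl] at h1
      simpa [PassMode.pass] using h1
    · rw [hl] at h2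
      simpa [PassMode.pass] using h2

/-- After `n` moves to the left the heads are at cell `-1`, whose blank costs one more step to turn
around. -/
theorem rewind (w : List Digit) {n : ℕ} (hn : n ≤ w.length) :
    (searchTM.step φ)^[n + 1] (cfg .rewind (tapeOf w) O Q ((n : ℤ) - 1) o ((n : ℤ) - 1)) =
      cfg .query (tapeOf w) O Q 0 o 0 := by
  induction n with
  | zero =>
    rw [zero_add, Function.iterate_one, step_rewind_none (tapeOf_of_neg _ (by simp))]
    simp
  | succ n ih =>
    rw [Function.iterate_succ_apply, step_rewind (d := w[n])]
    · simpa using ih (by omega)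
    · rw [Nat.cast_succ, add_sub_cancel_right, tapeOf_natCast, List.getElem?_eq_getElem]

theorem answer (v : List Digit) (r : ℕ) {n : ℕ} (hn : n ≤ v.length) :
    (searchTM.step φ)^[n]
        (cfg .answer I (tapeOf (List.replicate r (Sum.inl false))) (tapeOf v) i 0 0) =
      cfg .answer I (tapeOf (List.replicate (max r n) (Sum.inl false))) (tapeOf v) i n n := by
  induction n with
  | zero => simp
  | succ n ih =>
    rw [Function.iterate_succ_apply', ih (by omega), step_answer (d := v[n]),
      update_tapeOf_replicate _ (le_max_right r n)]
    · rw [show max (max r n) (n + 1) = max r (n + 1) by omega]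
      simp
    · rw [tapeOf_natCast, List.getElem?_eq_getElem]

theorem back (v : List Digit) {n : ℕ} (hn : n ≤ v.length) :
    (searchTM.step φ)^[n + 1] (cfg .back I O (tapeOf v) i ((n : ℤ) - 1) ((n : ℤ) - 1)) =
      cfg (.scan .carry) I O (tapeOf v) i 0 0 := by
  induction n with
  | zero =>
    rw [zero_add, Function.iterate_one, step_back_none (tapeOf_of_neg _ (by simp))]
    simp
  | succ n ih =>
    rw [Function.iterate_succ_apply, step_back (d := v[n])]
    · simpa using ih (by omega)
    · rw [Nat.cast_succ, add_sub_cancel_right, tapeOf_natCast, List.getElem?_eq_getElem]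

/-- One round: a pass over the word on the input tape, a query, and the processing of the
answer. -/
theorem round (w : List Digit) {c : PassMode} (hc : (c.pass w).2 ≠ .carry) (r : ℕ)
    (Q : ℤ → TapeSym Unit) : ∃ Q' : ℤ → TapeSym Unit,
      (searchTM.step φ)^[2 * w.length + 2 * (φ (bitPrefix (c.pass w).1)).length + 5]
          (cfg (.scan c) (tapeOf w) (tapeOf (List.replicate r (Sum.inl false))) Q 0 0 0) =
        cfg (.scan .carry) (tapeOf (c.pass w).1)
          (tapeOf (List.replicate (max r (φ (bitPrefix (c.pass w).1)).length) (Sum.inl false)))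
          Q' 0 0 0 := by
  obtain ⟨Q₁, h1, h2⟩ := scan (φ := φ) (o := 0)
    (O := tapeOf (List.replicate r (Sum.inl false))) w [] c Q (by simp)
  have hl := c.length_pass w
  generalize c.pass w = p at *
  obtain ⟨w', c'⟩ := p
  simp only [List.nil_append, List.length_nil, zero_add, Nat.cast_zero] at h1 h2 hl hc ⊢
  set b := φ (bitPrefix w') with hb
  -- The blank written just behind the word cuts off what an earlier longer answer left there.
  have hQ : content (Function.update Q₁ (w.length : ℤ) none) = bitPrefix w' := by
    refine content_eq_bitPrefix w' fun i hi => ?_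
    rcases hi.lt_or_eq with hi | rfl
    · rw [Function.update_of_ne (by omega), h2 i (by omega)]
    · rw [hl]
      simp [← hl]
  refine ⟨tapeOf (b.map Sum.inl), ?_⟩
  -- From right to left: scan, turn, rewind, query, read the answer, turn, go back.
  have hsum : 2 * w.length + 2 * b.length + 5 =
      (b.length + 1) + (1 + (b.length + (1 + ((w.length + 1) + (1 + w.length))))) := by ring
  have hbl : b.length ≤ (b.map (Sum.inl : Bool → Digit)).length := by simp
  rw [hsum, Function.iterate_add_apply, Function.iterate_add_apply _ 1 (b.length + _),
    Function.iterate_add_apply _ b.length (1 + _), Function.iterate_add_apply _ 1 (_ + 1 + _),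
    Function.iterate_add_apply _ (w.length + 1), Function.iterate_add_apply _ 1, h1,
    Function.iterate_one, step_scan_none hc (by simp [hl]), rewind w' hl.ge, step_query, hQ,
    ← hb, answer _ r hbl, step_answer_none (by simp), back _ hbl]

theorem halts_of_carry (w : List Digit) (hc : (PassMode.carry.pass w).2 = .carry)
    (Q : ℤ → TapeSym Unit) : ∃ c : searchTM.Config,
      (searchTM.step φ)^[w.length + 1] (cfg (.scan .carry) (tapeOf w) O Q 0 o 0) = c ∧
        c.state = .halt ∧ c.cells .output = O := by
  obtain ⟨Q₁, h1, -⟩ := scan (φ := φ) (o := o) (O := O) w [] .carry Q (by simp)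
  simp only [List.nil_append, List.length_nil, zero_add, Nat.cast_zero, hc] at h1
  refine ⟨_, rfl, ?_⟩
  rw [Function.iterate_succ_apply', h1,
    step_scan_carry_none (by simp [PassMode.length_pass])]
  exact ⟨rfl, rfl⟩

/-- Invariant: `r` dominates the answers for all words up to `w` in the odometer order, and at most
`j` increments remain before overflow. -/
theorem loop {m B : ℕ} (hB : ∀ v : List Digit, v.length = m → (φ (bitPrefix v)).length ≤ B)
    (j : ℕ) (w : List Digit) (r : ℕ) (Q : ℤ → TapeSym Unit) (hw : w.length = m)
    (hj : 3 ^ m ≤ wordVal w + 1 + j) (hr : r ≤ B)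
    (hv : ∀ v : List Digit, v.length = m → wordVal v ≤ wordVal w →
      (φ (bitPrefix v)).length ≤ r) :
    ∃ t ≤ j * (2 * m + 2 * B + 5) + (m + 1), ∃ r' ≤ B, ∃ c : searchTM.Config,
      (searchTM.step φ)^[t] (cfg (.scan .carry) (tapeOf w)
        (tapeOf (List.replicate r (Sum.inl false))) Q 0 0 0) = c ∧ c.state = .halt ∧
      c.cells .output = tapeOf (List.replicate r' (Sum.inl false)) ∧
      ∀ v : List Digit, v.length = m → (φ (bitPrefix v)).length ≤ r' := by
  induction j generalizing w r Q with
  | zero =>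
    rcases PassMode.carry_pass w with ⟨h1, h2⟩ | ⟨h1, h2⟩
    · obtain ⟨c, hc, hs, ho⟩ := halts_of_carry (φ := φ) (o := 0)
        (O := tapeOf (List.replicate r (Sum.inl false))) w h1 Q
      refine ⟨_, by omega, r, hr, c, hc, hs, ho, fun v hvl => hv v hvl ?_⟩
      have := wordVal_lt v
      rw [hvl, ← hw] at this
      omega
    -- With no increments left, a successful one would produce a value of at least `3 ^ m`.
    · have := wordVal_lt (PassMode.carry.pass w).1
      rw [PassMode.length_pass, hw] at this
      omega
  | succ j ih =>
    rcases PassMode.carry_pass w with ⟨h1, h2⟩ | ⟨h1, h2⟩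
    · obtain ⟨c, hc, hs, ho⟩ := halts_of_carry (φ := φ) (o := 0)
        (O := tapeOf (List.replicate r (Sum.inl false))) w h1 Q
      refine ⟨_, by omega, r, hr, c, hc, hs, ho, fun v hvl => hv v hvl ?_⟩
      have := wordVal_lt v
      rw [hvl, ← hw] at this
      omega
    · obtain ⟨Q', hQ'⟩ := round (φ := φ) w (c := .carry) (by simp [h1]) r Q
      have hl : (PassMode.carry.pass w).1.length = m := by rw [PassMode.length_pass, hw]
      have hBw := hB _ hl
      obtain ⟨t, ht, r', hr', c, hc, hs, ho, hall⟩ := ih (PassMode.carry.pass w).1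
        (max r (φ (bitPrefix (PassMode.carry.pass w).1)).length) Q' hl (by omega)
        (max_le hr hBw) (by
          intro v hvl hvv
          rcases hvv.lt_or_eq with h | h
          · exact (hv v hvl (by omega)).trans (le_max_left _ _)
          · rw [eq_of_wordVal_eq (hvl.trans hl.symm) h]
            exact le_max_right _ _)
      refine ⟨t + (2 * w.length +
        2 * (φ (bitPrefix (PassMode.carry.pass w).1)).length + 5), ?_, r', hr', c, ?_, hs, ho, hall⟩
      · rw [Nat.succ_mul j, hw]
        omega
      · rw [Function.iterate_add_apply, hQ', hc]

theorem run_halts (φ : StrFun) (a : Str) :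
    ∃ t ≤ 3 ^ a.length * (2 * a.length + 2 * sizeFun φ a.length + 5) + (a.length + 1),
      (searchTM.run φ a t).state = .halt ∧
      content ((searchTM.run φ a t).cells .output) =
        List.replicate (sizeFun φ a.length) false := by
  set m := a.length with hm
  have hB (v : List Digit) (hv : v.length = m) : (φ (bitPrefix v)).length ≤ sizeFun φ m :=
    length_le_sizeFun φ ((length_bitPrefix_le v).trans hv.le)
  have hlen : (a.map (Sum.inl : Bool → Digit)).length = m := by simp [hm]
  obtain ⟨Q, hQ⟩ := round (φ := φ) (a.map Sum.inl) (c := .reset)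
    (by simp [PassMode.reset_pass]) 0 (fun _ => none)
  rw [PassMode.reset_pass, hlen] at hQ
  set w₀ : List Digit := List.replicate m (Sum.inl false) with hw₀
  have hw₀l : w₀.length = m := List.length_replicate
  have hw₀v : wordVal w₀ = 0 := wordVal_replicate m
  -- The initial reset round has handled the zero word; `3 ^ m - 1` words remain.
  obtain ⟨t, ht, r, hr, c, hc, hs, ho, hall⟩ := loop hB (3 ^ m - 1) w₀
    (max 0 (φ (bitPrefix w₀)).length) Q hw₀l (by omega) (by simpa using hB w₀ hw₀l) (by
      intro v hvl hv
      rw [eq_of_wordVal_eq (hvl.trans hw₀l.symm) (by omega)]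
      exact le_max_right _ _)
  have hrun : searchTM.run φ a (t + (2 * m + 2 * (φ (bitPrefix w₀)).length + 5)) = c := by
    rw [OracleTM.run, init_eq, Function.iterate_add_apply, ← hc, ← hQ]
    congr 3
    funext z
    simp [tapeOf]
  refine ⟨t + (2 * m + 2 * (φ (bitPrefix w₀)).length + 5), ?_, ?_, ?_⟩
  · have h3 : 3 ^ m = (3 ^ m - 1) + 1 := (Nat.sub_add_cancel (Nat.one_le_pow _ _ (by norm_num))).symm
    have := hB w₀ hw₀l
    rw [h3, Nat.succ_mul (3 ^ m - 1)]
    omega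
  · rw [hrun, hs]
  · have hrs : r = sizeFun φ m := by
      refine le_antisymm hr (sizeFun_le fun b hb => ?_)
      have := hall (b.map Sum.inl ++ List.replicate (m - b.length) (Sum.inr ())) (by simp; omega)
      rwa [bitPrefix_map_append] at this
    rw [hrun, ho, ← hrs]
    refine content_eq fun i _ => ?_
    rw [tapeOf_natCast, List.getElem?_replicate, List.getElem?_replicate]
    split_ifs <;> rfl

end searchTM

/-! ### The functional is polynomial-time computable on its domain -/

/-- Consecutive towers are squares of each other, so the least one above `m` is at most `m ^ 2`,
unless it is the first, which is `2`. -/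
theorem exists_tower_between (m : ℕ) : ∃ n : ℕ, m ≤ 2 ^ 2 ^ n ∧ 2 ^ 2 ^ n ≤ m ^ 2 + 2 := by
  have hex : ∃ n : ℕ, m ≤ 2 ^ 2 ^ n :=
    ⟨m, Nat.lt_two_pow_self.le.trans Nat.lt_two_pow_self.le⟩
  refine ⟨Nat.find hex, Nat.find_spec hex, ?_⟩
  rcases h : Nat.find hex with _ | n
  · simp
  · have : 2 ^ 2 ^ n < m := not_le.1 (Nat.find_min hex (by omega))
    calc 2 ^ 2 ^ (n + 1) = (2 ^ 2 ^ n) ^ 2 := by rw [← pow_mul, pow_succ]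
      _ ≤ m ^ 2 := by gcongr
      _ ≤ m ^ 2 + 2 := by omega

theorem two_pow_le_sizeFun {φ : StrFun} (hφ : ∀ n : ℕ, 2 ^ 2 ^ 2 ^ n ≤ sizeFun φ (2 ^ 2 ^ n))
    (m : ℕ) : 2 ^ m ≤ sizeFun φ (m ^ 2 + 2) := by
  obtain ⟨n, h1, h2⟩ := exists_tower_between m
  calc 2 ^ m ≤ 2 ^ 2 ^ 2 ^ n := by gcongr; norm_num
    _ ≤ sizeFun φ (2 ^ 2 ^ n) := hφ n
    _ ≤ _ := sizeFun_mono φ h2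

theorem mem_polyTimeOn {A : Set StrFun}
    (hA : A ⊆ {φ : StrFun | ∀ n : ℕ, 2 ^ 2 ^ 2 ^ n ≤ sizeFun φ (2 ^ 2 ^ n)}) {F : A → StrFun}
    (hF : ∀ (φ : A) (a : Str), F φ a = List.replicate (sizeFun φ a.length) false) :
    F ∈ PolyTimeOn A := by
  have hpoly (p : Polynomial ℕ) (f : ℕ → ℕ) (h : ∀ n, p.eval n = f n) :
      IsSecondOrderPoly fun _ n => f n := by
    have := IsSecondOrderPoly.poly p
    simpa only [h] using this
  have hS : IsSecondOrderPoly fun l n => l (n ^ 2 + 2) :=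
    (hpoly (Polynomial.X ^ 2 + 2) (fun n => n ^ 2 + 2) (by simp)).app
  have hid : IsSecondOrderPoly fun _ n => n := hpoly Polynomial.X (fun n => n) (by simp)
  have hconst (k : ℕ) : IsSecondOrderPoly fun _ _ => k :=
    hpoly (Polynomial.C k) (fun _ => k) (by simp)
  refine ⟨searchTM, fun l n =>
    -- The square of `l (n ^ 2 + 2)` bounds the number of rounds, since `3 ^ n ≤ (2 ^ n) ^ 2`; the
    -- next factor is the cost of a round, and `n + 1` pays for the overflowing pass.
    l (n ^ 2 + 2) * l (n ^ 2 + 2) * (2 * n + 2 * l n + 5) + (n + 1),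
    ((hS.mul hS).mul ((((hconst 2).mul hid).add ((hconst 2).mul hid.app)).add (hconst 5))).add
      (hid.add (hconst 1)), fun φ a => ?_, fun φ hφ a => ?_⟩
  · obtain ⟨t, -, h1, h2⟩ := searchTM.run_halts φ a
    exact ⟨t, h1, h2.trans (hF φ a).symm⟩
  · obtain ⟨t, ht, h1, -⟩ := searchTM.run_halts φ a
    refine OracleTM.time_le_iff.2 ⟨t, ht.trans ?_, h1⟩
    have h2 := two_pow_le_sizeFun (hA hφ) a.length
    have h3 : 3 ^ a.length ≤ sizeFun φ (a.length ^ 2 + 2) * sizeFun φ (a.length ^ 2 + 2) :=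
      calc 3 ^ a.length ≤ (2 * 2) ^ a.length := by gcongr; norm_num
        _ = 2 ^ a.length * 2 ^ a.length := mul_pow _ _ _
        _ ≤ _ := Nat.mul_le_mul h2 h2
    beta_reduce
    gcongr

theorem mainTheorem2 :
    (∀ A : Set StrFun, PolyTimeExtendable A ⊆ PolyTimeOn A) ∧
    ∃ (A : Set StrFun) (F : A → StrFun),
      A = {φ : StrFun | ∀ n : ℕ, 2 ^ 2 ^ 2 ^ n ≤ sizeFun φ (2 ^ 2 ^ n)} ∧
      (∀ (φ : A) (a : Str), F φ a = List.replicate (sizeFun φ a.length) false) ∧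
      F ∈ PolyTimeOn A ∧ F ∉ PolyTimeExtendable A :=
  ⟨PolyTimeExtendable_subset,
    {φ : StrFun | ∀ n : ℕ, 2 ^ 2 ^ 2 ^ n ≤ sizeFun φ (2 ^ 2 ^ n)},
    fun φ a => List.replicate (sizeFun φ a.length) false, rfl, fun _ _ => rfl,
    mem_polyTimeOn subset_rfl fun _ _ => rfl, not_polyTimeExtendable rfl fun _ _ => rfl⟩
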